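/- Let $M_n$ be the space of complex $n\times n$ matrices with the trace inner product $\langle A,B\rangle=\operatorname{tr}(AB^*)$. A linear map $T:M_k\to M_m$ is positive if it sends positive semidefinite Hermitian matrices to positive semidefinite Hermitian matrices; $T^*:M_m\to M_k$ denotes its adjoint for the trace inner products. A positive map $S:M_k\to M_m$ is doubly stochastic if $S(\mathrm{Id}/\sqrt k)=\mathrm{Id}/\sqrt m$ and $S^*(\mathrm{Id}/\sqrt m)=\mathrm{Id}/\sqrt k$. Maps $T,T_1:M_k\to M_m$ are equivalent if there are invertible $X'\in M_k$, $Y'\in M_m$ with $T_1(X)=Y'T(X'XX'^*)Y'^*$ for all $X\in M_k$. A square matrix $B=(b_{ij})$ of order $n$ has total support if for every $(i_0,j_0)$ with $b_{i_0j_0}\neq 0$ there is a permutation $\sigma$ of $\{1,\dots,n\}$ with $\sigma(i_0)=j_0$ and $\prod_{i=1}^n b_{i\sigma(i)}\ne 0$. A matrix $A\in M_{k\times m}$ has total support if the Kronecker product $A\otimes 1_{m\times k}\in M_{km}$ has total support, where $1_{m\times k}$ is the $m\times k$ matrix with all entries $1$. A linear map $T:M_k\to M_m$ has total support if for all orthonormal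 bases $\{v_1,\dots,v_k\}$ of $\mathbb C^k$ and $\{w_1,\dots,w_m\}$ of $\mathbb C^m$ the matrix $\big(\operatorname{tr}(T(v_iv_i^*)\,w_jw_j^*)\big)_{i,j}\in M_{k\times m}$ has total support. **Theorem.** A positive map $T:M_k\to M_m$ is equivalent to a doubly stochastic map if and only if $T(\mathrm{Id})$ and $T^*(\mathrm{Id})$ are positive definite Hermitian matrices and there are invertible matrices $X'\in M_k$, $Y'\in M_m$ such that the map $X\mapsto Y'T(X'XX'^*)Y'^*$ has total support. -/

import Mathlib

open scoped Matrix Kronecker ComplexOrder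

namespace PosMap

/-- A linear map `T : M_k → M_m` is positive if it sends positive semidefinite Hermitian
matrices to positive semidefinite Hermitian matrices. -/
def IsPositiveMap {k m : ℕ}
    (T : Matrix (Fin k) (Fin k) ℂ →ₗ[ℂ] Matrix (Fin m) (Fin m) ℂ) : Prop :=
  ∀ A : Matrix (Fin k) (Fin k) ℂ, A.PosSemidef → (T A).PosSemidef

/-- The adjoint `T*` of `T : M_k → M_m` with respect to the trace inner product
`⟨A, B⟩ = tr (A B*)`; see `trace_map_mul_conjTranspose` and `eq_traceAdjoint`. -/
def traceAdjoint {k m : ℕ}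
    (T : Matrix (Fin k) (Fin k) ℂ →ₗ[ℂ] Matrix (Fin m) (Fin m) ℂ) :
    Matrix (Fin m) (Fin m) ℂ →ₗ[ℂ] Matrix (Fin k) (Fin k) ℂ where
  toFun B := Matrix.of fun i j => star (Matrix.trace (T (Matrix.single i j 1) * Bᴴ))
  map_add' B C := by
    ext i j
    simp [Matrix.mul_add, Matrix.trace_add]
  map_smul' c B := by
    ext i j
    simp [Matrix.trace_smul]

/-- `⟨T A, B⟩ = ⟨A, T* B⟩`. -/
theorem trace_map_mul_conjTranspose {k m : ℕ}
    (T : Matrix (Fin k) (Fin k) ℂ →ₗ[ℂ] Matrix (Fin m) (Fin m) ℂ)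
    (A : Matrix (Fin k) (Fin k) ℂ) (B : Matrix (Fin m) (Fin m) ℂ) :
    Matrix.trace (T A * Bᴴ) = Matrix.trace (A * (traceAdjoint T B)ᴴ) := by
  have hA : T A = ∑ i, ∑ j, A i j • T (Matrix.single i j 1) := by
    conv_lhs => rw [Matrix.matrix_eq_sum_single A]
    simp only [map_sum]
    refine Finset.sum_congr rfl fun i _ => Finset.sum_congr rfl fun j _ => ?_
    rw [← map_smul]
    simp [Matrix.smul_single]
  rw [hA]
  simp only [Finset.sum_mul, Matrix.trace_sum, Matrix.smul_mul, Matrix.trace_smul, smul_eq_mul]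
  simp [Matrix.trace, Matrix.mul_apply, traceAdjoint]

/-- The adjoint is determined by the identity `⟨T A, B⟩ = ⟨A, T* B⟩`. -/
theorem eq_traceAdjoint {k m : ℕ}
    (T : Matrix (Fin k) (Fin k) ℂ →ₗ[ℂ] Matrix (Fin m) (Fin m) ℂ)
    (S : Matrix (Fin m) (Fin m) ℂ →ₗ[ℂ] Matrix (Fin k) (Fin k) ℂ)
    (h : ∀ A B, Matrix.trace (T A * Bᴴ) = Matrix.trace (A * (S B)ᴴ)) :
    S = traceAdjoint T := by
  ext B i j
  simp [traceAdjoint, h, Matrix.trace_single_mul]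

/-- A positive map `T : M_k → M_m` is doubly stochastic if `T (Id / √k) = Id / √m` and
`T* (Id / √m) = Id / √k`. -/
structure IsDoublyStochastic {k m : ℕ}
    (T : Matrix (Fin k) (Fin k) ℂ →ₗ[ℂ] Matrix (Fin m) (Fin m) ℂ) : Prop where
  positive : IsPositiveMap T
  map_id : T (((Real.sqrt k : ℝ) : ℂ)⁻¹ • 1) = ((Real.sqrt m : ℝ) : ℂ)⁻¹ • 1
  adjoint_map_id :
    traceAdjoint T (((Real.sqrt m : ℝ) : ℂ)⁻¹ • 1) = ((Real.sqrt k : ℝ) : ℂ)⁻¹ • 1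

/-- The map `X ↦ Y' T(X' X X'*) Y'*`. -/
def scale {k m : ℕ}
    (T : Matrix (Fin k) (Fin k) ℂ →ₗ[ℂ] Matrix (Fin m) (Fin m) ℂ)
    (X' : Matrix (Fin k) (Fin k) ℂ) (Y' : Matrix (Fin m) (Fin m) ℂ) :
    Matrix (Fin k) (Fin k) ℂ →ₗ[ℂ] Matrix (Fin m) (Fin m) ℂ where
  toFun X := Y' * T (X' * X * X'ᴴ) * Y'ᴴ
  map_add' A B := by simp [Matrix.mul_add, Matrix.add_mul]
  map_smul' c A := by simp

/-- `T` and `T₁` are equivalent if `T₁ (X) = Y' T(X' X X'*) Y'*` for all `X`, for some invertible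
`X'` and `Y'`. -/
def AreEquivalent {k m : ℕ}
    (T T₁ : Matrix (Fin k) (Fin k) ℂ →ₗ[ℂ] Matrix (Fin m) (Fin m) ℂ) : Prop :=
  ∃ (X' : Matrix (Fin k) (Fin k) ℂ) (Y' : Matrix (Fin m) (Fin m) ℂ),
    IsUnit X' ∧ IsUnit Y' ∧ T₁ = scale T X' Y'

/-- Total support of a square matrix: every nonzero entry lies on a generalized diagonal without
zeros. Rows and columns may be indexed by two different sets `ι`, `κ` of the same size; for
`ι = κ` the bijection `σ` is a permutation. The choice of an order on `ι` and `κ` does not matter,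
see `squareTotalSupport_reindex`. -/
def SquareTotalSupport {ι κ : Type*} [Fintype ι] (A : Matrix ι κ ℂ) : Prop :=
  ∀ i₀ j₀, A i₀ j₀ ≠ 0 → ∃ σ : ι ≃ κ, σ i₀ = j₀ ∧ ∏ i, A i (σ i) ≠ 0

theorem squareTotalSupport_reindex {ι κ ι' κ' : Type*} [Fintype ι] [Fintype ι']
    (A : Matrix ι κ ℂ) (e : ι ≃ ι') (f : κ ≃ κ') :
    SquareTotalSupport (A.reindex e f) ↔ SquareTotalSupport A := by
  constructor
  · intro h i₀ j₀ hij
    obtain ⟨σ, h1, h2⟩ := h (e i₀) (f j₀) (by simpa using hij)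
    refine ⟨(e.trans σ).trans f.symm, by simp [h1], ?_⟩
    rw [← Equiv.prod_comp e] at h2
    simpa using h2
  · intro h i₀ j₀ hij
    obtain ⟨σ, h1, h2⟩ := h (e.symm i₀) (f.symm j₀) (by simpa using hij)
    refine ⟨(e.symm.trans σ).trans f, by simp [h1], ?_⟩
    rw [← Equiv.prod_comp e]
    simpa using h2

/-- A rectangular matrix `A ∈ M_{k×m}` has total support if the square matrix
`A ⊗ 1_{m×k}` of order `km` has total support, where `1_{m×k}` is the all-ones matrix. -/
def RectTotalSupport {k m : ℕ} (A : Matrix (Fin k) (Fin m) ℂ) : Prop :=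
  SquareTotalSupport (A ⊗ₖ (Matrix.of fun (_ : Fin m) (_ : Fin k) => (1 : ℂ)))

/-- The matrix `(tr (T(v_i v_i*) w_j w_j*))_{ij} ∈ M_{k×m}`. -/
noncomputable def traceMatrix {k m : ℕ}
    (T : Matrix (Fin k) (Fin k) ℂ →ₗ[ℂ] Matrix (Fin m) (Fin m) ℂ)
    (v : Fin k → EuclideanSpace ℂ (Fin k)) (w : Fin m → EuclideanSpace ℂ (Fin m)) :
    Matrix (Fin k) (Fin m) ℂ :=
  Matrix.of fun i j =>
    Matrix.trace (T (Matrix.vecMulVec (fun a => v i a) (fun a => star (v i a))) *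
      Matrix.vecMulVec (fun b => w j b) (fun b => star (w j b)))

/-- `T : M_k → M_m` has total support if, for all orthonormal bases `v` of `ℂ^k` and `w` of `ℂ^m`,
the matrix `(tr (T(v_i v_i*) w_j w_j*))_{ij}` has total support. -/
def HasTotalSupport {k m : ℕ}
    (T : Matrix (Fin k) (Fin k) ℂ →ₗ[ℂ] Matrix (Fin m) (Fin m) ℂ) : Prop :=
  ∀ (v : OrthonormalBasis (Fin k) ℂ (EuclideanSpace ℂ (Fin k)))
    (w : OrthonormalBasis (Fin m) ℂ (EuclideanSpace ℂ (Fin m))),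
    RectTotalSupport (traceMatrix T v w)

end PosMap

/-! Sufficiency is variational. After a preliminary scaling, `T` itself has total support. Let `E(X,
Y) = tr (T(X) Y) - m log det X - k log det Y` on pairs of positive definite matrices. If `(C Cᴴ, D
Dᴴ)` minimises `E`, the congruence by `C` and `D` moves the minimiser to `(1, 1)`, and the
first-order conditions there say that the scaled map sends `1` to `k • 1` and its adjoint sends `1`
to `m • 1`. A scalar factor then makes it doubly stochastic.

The domain is not compact, so existence of the minimiser is the main point. For fixed eigenvectors
`v`, `w` and eigenvalues `exp x`, `exp y`, the energy is the scaling potential of the matrix `tr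
(T(v_i v_i*) w_j w_j*)`. Total support yields a matrix with the same zero pattern and constant row
and column sums, which makes the potential coercive modulo its invariances, so a minimum exists
(`BalancedSupport.exists_forall_le`). The minimum value is lower semicontinuous in `(v, w)`
(`sub_le_scalingPotential`), and pairs of orthonormal frames form a compact set
(`HasTotalSupport.exists_energy_le`).

Necessity is Birkhoff–von Neumann: for a doubly stochastic map every trace matrix has constant row
and column sums, hence total support. Strict positivity at the identity survives invertible
scalings. -/

namespace PosMap

open Filter Topology

/-! ### Scaling potentials of nonnegative matrices -/

section Potential

variable {ι κ : Type*} [Fintype ι] [Fintype κ]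

/-- The potential whose critical points are the scalings of `A` with row sums `a` and column
sums `b`. -/
noncomputable def scalingPotential (A : Matrix ι κ ℝ) (a b : ℝ) (x : ι → ℝ) (y : κ → ℝ) : ℝ :=
  ∑ i, ∑ j, A i j * Real.exp (x i + y j) - a * ∑ i, x i - b * ∑ j, y j

/-- `A` has the same zero pattern as a nonnegative matrix with row sums `a` and column
sums `b`. -/
def BalancedSupport (A : Matrix ι κ ℝ) (a b : ℝ) : Prop :=
  ∃ P : Matrix ι κ ℝ, (∀ i j, 0 ≤ P i j) ∧ (∀ i j, 0 < P i j ↔ 0 < A i j) ∧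
    (∀ i, ∑ j, P i j = a) ∧ ∀ j, ∑ i, P i j = b

theorem exists_mul_abs_sub_le_exp {a p : ℝ} (ha : 0 < a) (hp : 0 < p) :
    ∃ C, ∀ t : ℝ, p * |t| - C ≤ a * Real.exp t - p * t := by
  -- At `s` the function `a * exp` has slope `2 * p`; its tangent line there beats `p * t` with
  -- slope `p` to spare.
  set s := Real.log (2 * p / a)
  have hs : a * Real.exp s = 2 * p := by
    rw [Real.exp_log (by positivity)]; field_simp
  refine ⟨max 0 (2 * p * (s - 1)), fun t => ?_⟩
  rcases le_total 0 t with ht | ht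
  · have h1 : a * Real.exp t = 2 * p * Real.exp (t - s) := by
      rw [← hs, mul_assoc, ← Real.exp_add]; ring_nf
    have h2 := Real.add_one_le_exp (t - s)
    have h3 : 2 * p * (t - s + 1) ≤ 2 * p * Real.exp (t - s) := by gcongr
    rw [abs_of_nonneg ht, h1]
    linarith [le_max_right 0 (2 * p * (s - 1))]
  · rw [abs_of_nonpos ht]
    have := le_max_left 0 (2 * p * (s - 1))
    have := mul_pos ha (Real.exp_pos t)
    linarith

theorem tendsto_sum_exp_sub_cocompact {σ : Type*} [Fintype σ] {a p : σ → ℝ}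
    (ha : ∀ s, 0 < a s) (hp : ∀ s, 0 < p s) :
    Tendsto (fun z : σ → ℝ => ∑ s, (a s * Real.exp (z s) - p s * z s)) (cocompact (σ → ℝ))
      atTop := by
  choose C hC using fun s => exists_mul_abs_sub_le_exp (ha s) (hp s)
  set K := ∑ s, (p s)⁻¹ + 1
  have hpi : ∀ s, 0 < (p s)⁻¹ := fun s => inv_pos.2 (hp s)
  have hK : 0 < K := by
    have : 0 ≤ ∑ s, (p s)⁻¹ := Finset.sum_nonneg fun s _ => (hpi s).le
    linarith
  have hlin : Tendsto (fun z : σ → ℝ => K⁻¹ * ‖z‖ + -∑ s, C s) (cocompact (σ → ℝ)) atTop :=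
    tendsto_atTop_add_const_right _ _
      ((tendsto_norm_cocompact_atTop (E := σ → ℝ)).const_mul_atTop (inv_pos.2 hK))
  refine tendsto_atTop_mono (fun z => ?_) hlin
  set G := ∑ s, (a s * Real.exp (z s) - p s * z s) + ∑ s, C s with hG
  have hterm : ∀ s, p s * |z s| ≤ (a s * Real.exp (z s) - p s * z s) + C s := fun s => by
    linarith [hC s (z s)]
  have hsum : ∑ s, p s * |z s| ≤ G := by
    rw [hG, ← Finset.sum_add_distrib]
    exact Finset.sum_le_sum fun s _ => hterm s
  have hG0 : 0 ≤ G :=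
    (Finset.sum_nonneg fun s _ => mul_nonneg (hp s).le (abs_nonneg _)).trans hsum
  have hnorm : ‖z‖ ≤ K * G := by
    refine (pi_norm_le_iff_of_nonneg (by positivity)).2 fun s => ?_
    have h1 : p s * |z s| ≤ G :=
      (Finset.single_le_sum (f := fun s => p s * |z s|)
        (fun s _ => mul_nonneg (hp s).le (abs_nonneg _)) (Finset.mem_univ s)).trans hsum
    have h2 : (p s)⁻¹ ≤ K := by
      have := Finset.single_le_sum (f := fun s => (p s)⁻¹) (fun s _ => (hpi s).le)
        (Finset.mem_univ s)
      linarith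
    calc ‖z s‖ = (p s)⁻¹ * (p s * |z s|) := by
          rw [Real.norm_eq_abs, inv_mul_cancel_left₀ (hp s).ne']
      _ ≤ K * G := mul_le_mul h2 h1 (mul_nonneg (hp s).le (abs_nonneg _)) hK.le
  have : K⁻¹ * ‖z‖ ≤ G := by
    rw [inv_mul_le_iff₀ hK]; exact hnorm
  linarith

/-- The row and column sums of `P` turn the linear terms into `∑ P i j * (x i + y j)`, and off the
common support every summand vanishes. Each remaining term is coercive in `x i + y j`. -/
theorem scalingPotential_eq_sum_support {A P : Matrix ι κ ℝ} {a b : ℝ} (hA : ∀ i j, 0 ≤ A i j)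
    (hP0 : ∀ i j, 0 ≤ P i j) (hP : ∀ i j, 0 < P i j ↔ 0 < A i j)
    (hrow : ∀ i, ∑ j, P i j = a) (hcol : ∀ j, ∑ i, P i j = b) (x : ι → ℝ) (y : κ → ℝ) :
    scalingPotential A a b x y = ∑ s : {s : ι × κ // 0 < A s.1 s.2},
      (A s.1.1 s.1.2 * Real.exp (x s.1.1 + y s.1.2) - P s.1.1 s.1.2 * (x s.1.1 + y s.1.2)) := by
  classical
  have h1 : a * ∑ i, x i = ∑ i, ∑ j, P i j * x i := by
    rw [Finset.mul_sum]
    exact Finset.sum_congr rfl fun i _ => by rw [← hrow i, Finset.sum_mul]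
  have h2 : b * ∑ j, y j = ∑ i, ∑ j, P i j * y j := by
    rw [Finset.mul_sum, Finset.sum_comm]
    exact Finset.sum_congr rfl fun j _ => by rw [← hcol j, Finset.sum_mul]
  set F : ι × κ → ℝ := fun s => A s.1 s.2 * Real.exp (x s.1 + y s.2) - P s.1 s.2 * (x s.1 + y s.2)
  have h3 : scalingPotential A a b x y = ∑ s : ι × κ, F s := by
    rw [scalingPotential, h1, h2, Fintype.sum_prod_type, ← Finset.sum_sub_distrib,
      ← Finset.sum_sub_distrib]
    refine Finset.sum_congr rfl fun i _ => ?_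
    rw [← Finset.sum_sub_distrib, ← Finset.sum_sub_distrib]
    exact Finset.sum_congr rfl fun j _ => by simp only [F]; ring
  rw [h3]
  change _ = ∑ s : {s : ι × κ // 0 < A s.1 s.2}, F s.1
  rw [← Finset.sum_subtype (Finset.univ.filter fun s : ι × κ => 0 < A s.1 s.2) (by simp) F]
  refine (Finset.sum_filter_of_ne fun s _ hs => ?_).symm
  by_contra h
  have hA0 : A s.1 s.2 = 0 := le_antisymm (not_lt.1 h) (hA _ _)
  have hP0 : P s.1 s.2 = 0 := le_antisymm (not_lt.1 (mt (hP _ _).1 h)) (hP0 _ _)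
  exact hs (by simp [F, hA0, hP0])

theorem BalancedSupport.exists_forall_le {A : Matrix ι κ ℝ} {a b : ℝ} (hA : ∀ i j, 0 ≤ A i j)
    (h : BalancedSupport A a b) :
    ∃ x y, ∀ x' y', scalingPotential A a b x y ≤ scalingPotential A a b x' y' := by
  obtain ⟨P, hP0, hP, hrow, hcol⟩ := h
  -- The potential sees `(x, y)` only through the sums `x i + y j` on the support, so it need not be
  -- coercive in `(x, y)`. It is coercive in these sums, which range over a closed subspace.
  let f : (ι → ℝ) × (κ → ℝ) →ₗ[ℝ] ({s : ι × κ // 0 < A s.1 s.2} → ℝ) :=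
    { toFun := fun u s => u.1 s.1.1 + u.2 s.1.2
      map_add' := fun u u' => by ext s; simp; ring
      map_smul' := fun c u => by ext s; simp; ring }
  set g : ({s : ι × κ // 0 < A s.1 s.2} → ℝ) → ℝ := fun z =>
    ∑ s, (A s.1.1 s.1.2 * Real.exp (z s) - P s.1.1 s.1.2 * z s)
  have hfg : ∀ x y, scalingPotential A a b x y = g (f (x, y)) := fun x y =>
    scalingPotential_eq_sum_support hA hP0 hP hrow hcol x y
  have hg : Continuous g := by fun_prop
  have htend : Tendsto g (cocompact _) atTop :=
    tendsto_sum_exp_sub_cocompact (fun s => s.2) fun s => (hP _ _).2 s.2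
  obtain ⟨z, ⟨u, rfl⟩, hz⟩ := hg.continuousOn.exists_isMinOn'
    (s := (LinearMap.range f : Set _)) (Submodule.closed_of_finiteDimensional _)
    (x₀ := f 0) ⟨0, rfl⟩ ((htend.eventually_ge_atTop _).filter_mono inf_le_left)
  refine ⟨u.1, u.2, fun x' y' => ?_⟩
  rw [hfg, hfg]
  exact hz ⟨(x', y'), rfl⟩

/-- Shifting every `x i` by `-δ` absorbs the factor `exp (-δ)` at the cost `δ * a * card ι`. Only a
lower bound on `B` is needed, so `B` may have larger support than `A`; this is what gives lower
semicontinuity of the minimum. -/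
theorem sub_le_scalingPotential {A B : Matrix ι κ ℝ} {a b δ : ℝ} {x₀ : ι → ℝ} {y₀ : κ → ℝ}
    (h₀ : ∀ x y, scalingPotential A a b x₀ y₀ ≤ scalingPotential A a b x y)
    (hAB : ∀ i j, A i j * Real.exp (-δ) ≤ B i j) (x : ι → ℝ) (y : κ → ℝ) :
    scalingPotential A a b x₀ y₀ - δ * (a * Fintype.card ι) ≤ scalingPotential B a b x y := by
  have h1 := h₀ (fun i => x i - δ) y
  have h2 : ∑ i, ∑ j, A i j * Real.exp (x i - δ + y j) ≤
      ∑ i, ∑ j, B i j * Real.exp (x i + y j) := by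
    refine Finset.sum_le_sum fun i _ => Finset.sum_le_sum fun j _ => ?_
    have : x i - δ + y j = -δ + (x i + y j) := by ring
    rw [this, Real.exp_add, ← mul_assoc]
    exact mul_le_mul_of_nonneg_right (hAB i j) (Real.exp_pos _).le
  have h3 : ∑ i, (x i - δ) = ∑ i, x i - δ * Fintype.card ι := by
    rw [Finset.sum_sub_distrib]; simp [mul_comm]
  unfold scalingPotential at *
  rw [h3] at h1
  linarith

end Potential

/-! ### Total support and constant row and column sums -/

section TotalSupport

variable {k m : ℕ}

/-- Each support entry lies on a nonzero diagonal of the Kronecker product. Counting how often this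
diagonal meets each block gives a matrix with row sums `m`, column sums `k` and support inside that
of `R`. The average over all support entries has exactly the support of `R`. -/
theorem RectTotalSupport.balancedSupport {A : Matrix (Fin k) (Fin m) ℂ} (h : RectTotalSupport A)
    {R : Matrix (Fin k) (Fin m) ℝ} (hR : ∀ i j, A i j ≠ 0 ↔ 0 < R i j)
    (hcol : ∀ j, ∃ i, 0 < R i j) : BalancedSupport R m k := by
  classical
  -- With empty support there is nothing to average; no column can then exist, so `m = 0` and the
  -- zero matrix works.
  rcases isEmpty_or_nonempty {s : Fin k × Fin m // 0 < R s.1 s.2} with hS | hS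
  · have hm : IsEmpty (Fin m) := ⟨fun j => by
      obtain ⟨i, hi⟩ := hcol j
      exact hS.elim ⟨(i, j), hi⟩⟩
    have hm0 : m = 0 := by simpa only [Fintype.card_fin] using Fintype.card_eq_zero_iff.2 hm
    exact ⟨0, by simp, fun i j => hm.elim j, by simp [hm0], fun j => hm.elim j⟩
  have key : ∀ s : {s : Fin k × Fin m // 0 < R s.1 s.2}, ∃ σ : Fin k × Fin m ≃ Fin m × Fin k,
      σ s.1 = (s.1.2, s.1.1) ∧ ∀ u, 0 < R u.1 (σ u).1 := by
    intro s
    obtain ⟨σ, h1, h2⟩ := h s.1 (s.1.2, s.1.1) (by simpa using (hR _ _).2 s.2)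
    refine ⟨σ, h1, fun u => (hR _ _).1 ?_⟩
    simpa using Finset.prod_ne_zero_iff.1 h2 u (Finset.mem_univ u)
  choose σ hσ hpos using key
  set N : {s : Fin k × Fin m // 0 < R s.1 s.2} → Matrix (Fin k) (Fin m) ℝ := fun s i j =>
    ∑ p, if (σ s (i, p)).1 = j then 1 else 0 with hN
  have hN0 : ∀ s i j, 0 ≤ N s i j := fun s i j =>
    Finset.sum_nonneg fun p _ => by split_ifs <;> norm_num
  have hNR : ∀ s i j, N s i j ≠ 0 → 0 < R i j := by
    intro s i j hne
    obtain ⟨p, -, hp⟩ := Finset.exists_ne_zero_of_sum_ne_zero hne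
    have hj : (σ s (i, p)).1 = j := by by_contra hj; simp [hj] at hp
    exact hj ▸ hpos s (i, p)
  have hNpos : ∀ s, 0 < N s s.1.1 s.1.2 := fun s => by
    refine Finset.sum_pos' (fun p _ => by split_ifs <;> norm_num) ⟨s.1.2, Finset.mem_univ _, ?_⟩
    simp [hσ]
  have hNrow : ∀ s i, ∑ j, N s i j = m := fun s i => by
    simp only [hN]
    rw [Finset.sum_comm]
    simp
  have hNcol : ∀ s j, ∑ i, N s i j = k := fun s j => by
    simp only [hN]
    rw [← Fintype.sum_prod_type (f := fun u : Fin k × Fin m =>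
      if (σ s u).1 = j then (1 : ℝ) else 0), Equiv.sum_comp (σ s)
      (fun u => if u.1 = j then (1 : ℝ) else 0), Fintype.sum_prod_type, Finset.sum_comm]
    simp
  set c : ℝ := (Fintype.card {s : Fin k × Fin m // 0 < R s.1 s.2} : ℝ)
  have hc : 0 < c := by simpa [c] using Fintype.card_pos
  refine ⟨fun i j => c⁻¹ * ∑ s, N s i j,
    fun i j => mul_nonneg (inv_nonneg.2 hc.le) (Finset.sum_nonneg fun s _ => hN0 s i j),
    fun i j => ⟨fun hij => ?_, fun hij => ?_⟩, fun i => ?_, fun j => ?_⟩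
  · obtain ⟨s, -, hs⟩ := Finset.exists_ne_zero_of_sum_ne_zero (right_ne_zero_of_mul hij.ne')
    exact hNR s i j hs
  · exact mul_pos (inv_pos.2 hc) (Finset.sum_pos' (fun s _ => hN0 s i j)
      ⟨⟨(i, j), hij⟩, Finset.mem_univ _, hNpos ⟨(i, j), hij⟩⟩)
  · rw [← Finset.mul_sum, Finset.sum_comm]
    simp only [hNrow, Finset.sum_const, Finset.card_univ, nsmul_eq_mul]
    exact inv_mul_cancel_left₀ hc.ne' _
  · rw [← Finset.mul_sum, Finset.sum_comm]
    simp only [hNcol, Finset.sum_const, Finset.card_univ, nsmul_eq_mul]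
    exact inv_mul_cancel_left₀ hc.ne' _

/-- In a Birkhoff decomposition, some permutation of nonzero weight passes through `(i, j)`, and all
entries along it are positive. -/
theorem exists_perm_forall_pos {n : Type*} [Fintype n] [DecidableEq n] {M : Matrix n n ℝ}
    (hM : M ∈ doublyStochastic ℝ n) {i j : n} (hij : M i j ≠ 0) :
    ∃ σ : Equiv.Perm n, σ i = j ∧ ∀ i, M i (σ i) ≠ 0 := by
  obtain ⟨w, hw, -, rfl⟩ := exists_eq_sum_perm_of_mem_doublyStochastic hM
  have happ : ∀ i j, (∑ σ, w σ • σ.permMatrix ℝ) i j =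
      ∑ σ : Equiv.Perm n, if σ i = j then w σ else 0 := fun i j => by
    rw [Matrix.sum_apply]
    refine Finset.sum_congr rfl fun σ _ => ?_
    simp [Equiv.Perm.permMatrix, PEquiv.toMatrix_apply, eq_comm]
  rw [happ] at hij
  obtain ⟨σ, -, hσ⟩ := Finset.exists_ne_zero_of_sum_ne_zero hij
  have h1 : σ i = j := by by_contra h; simp [h] at hσ
  refine ⟨σ, h1, fun i => ?_⟩
  rw [happ]
  refine (Finset.sum_pos' (fun τ _ => ?_) ⟨σ, Finset.mem_univ _, ?_⟩).ne'
  · split_ifs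
    exacts [hw τ, le_rfl]
  · simp only [h1, if_true] at hσ ⊢
    exact (hw σ).lt_of_ne' hσ

theorem rectTotalSupport_of_sum_eq {A : Matrix (Fin k) (Fin m) ℂ} {R : Matrix (Fin k) (Fin m) ℝ}
    (hA : ∀ i j, A i j = R i j) (hR : ∀ i j, 0 ≤ R i j) {a b : ℝ}
    (hrow : ∀ i, ∑ j, R i j = a) (hcol : ∀ j, ∑ i, R i j = b) : RectTotalSupport A := by
  classical
  intro u₀ v₀ h₀
  have h₀ : R u₀.1 v₀.1 ≠ 0 := by simpa [hA] using h₀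
  have hab : (k : ℝ) * a = m * b := by
    have := Finset.sum_comm (s := Finset.univ) (t := Finset.univ) (f := R)
    simpa [hrow, hcol] using this
  have ha : 0 < k * a := by
    have h1 : R u₀.1 v₀.1 ≤ a := hrow u₀.1 ▸
      Finset.single_le_sum (fun j _ => hR u₀.1 j) (Finset.mem_univ v₀.1)
    have h2 : (0 : ℝ) < k := by exact_mod_cast u₀.1.pos
    exact mul_pos h2 (((hR _ _).lt_of_ne' h₀).trans_le h1)
  -- This is `A ⊗ 1` with its column index pair swapped and divided by its common row and column sum
  -- `k * a = m * b`.
  have hM : (Matrix.of fun u v : Fin k × Fin m => (k * a)⁻¹ * R u.1 v.2) ∈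
      doublyStochastic ℝ (Fin k × Fin m) := by
    rw [mem_doublyStochastic_iff_sum]
    refine ⟨fun u v => mul_nonneg (inv_nonneg.2 ha.le) (hR _ _), fun u => ?_, fun v => ?_⟩
    · simp only [Matrix.of_apply, ← Finset.mul_sum, Fintype.sum_prod_type, hrow]
      simpa using inv_mul_cancel₀ ha.ne'
    · simp only [Matrix.of_apply, ← Finset.mul_sum, Fintype.sum_prod_type]
      rw [Finset.sum_comm]
      simp only [hcol]
      simpa [← hab] using inv_mul_cancel₀ ha.ne'
  obtain ⟨σ, h1, h2⟩ := exists_perm_forall_pos hM (i := u₀) (j := v₀.swap)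
    (mul_ne_zero (inv_ne_zero ha.ne') h₀)
  refine ⟨σ.trans (Equiv.prodComm _ _), by simp [h1], Finset.prod_ne_zero_iff.2 fun u _ => ?_⟩
  simpa [hA] using right_ne_zero_of_mul (h2 u)

end TotalSupport

/-! ### Hermitian matrices in orthonormal frames -/

section Frame

variable {n : ℕ}

/-- The matrix with columns `v i`. -/
noncomputable def frameMatrix (v : Fin n → EuclideanSpace ℂ (Fin n)) : Matrix (Fin n) (Fin n) ℂ :=
  Matrix.of fun a i => v i a

/-- The Hermitian matrix with eigenvectors `v i` and eigenvalues `d i`. -/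
noncomputable def frameDiagonal (v : Fin n → EuclideanSpace ℂ (Fin n)) (d : Fin n → ℝ) :
    Matrix (Fin n) (Fin n) ℂ :=
  frameMatrix v * Matrix.diagonal (fun i => (d i : ℂ)) * (frameMatrix v)ᴴ

theorem frameDiagonal_eq_sum (v : Fin n → EuclideanSpace ℂ (Fin n)) (d : Fin n → ℝ) :
    frameDiagonal v d =
      ∑ i, (d i : ℂ) • Matrix.vecMulVec (fun a => v i a) (fun a => star (v i a)) := by
  ext a b
  simp [frameDiagonal, frameMatrix, Matrix.mul_apply, Matrix.sum_apply, Matrix.vecMulVec_apply,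
    Matrix.diagonal_apply]
  exact Finset.sum_congr rfl fun i _ => by ring

theorem conjTranspose_frameMatrix_mul {v : Fin n → EuclideanSpace ℂ (Fin n)}
    (hv : Orthonormal ℂ v) : (frameMatrix v)ᴴ * frameMatrix v = 1 := by
  ext i j
  have := (orthonormal_iff_ite.1 hv) i j
  rw [PiLp.inner_apply] at this
  simp only [Matrix.mul_apply, frameMatrix, Matrix.conjTranspose_apply, Matrix.of_apply,
    Matrix.one_apply, ← this]
  exact Finset.sum_congr rfl fun a _ => by simp [mul_comm]

theorem frameMatrix_mul_conjTranspose {v : Fin n → EuclideanSpace ℂ (Fin n)}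
    (hv : Orthonormal ℂ v) : frameMatrix v * (frameMatrix v)ᴴ = 1 :=
  mul_eq_one_comm.1 (conjTranspose_frameMatrix_mul hv)

theorem frameDiagonal_const {v : Fin n → EuclideanSpace ℂ (Fin n)} (hv : Orthonormal ℂ v)
    (c : ℝ) : frameDiagonal v (fun _ => c) = (c : ℂ) • 1 := by
  rw [frameDiagonal, ← Matrix.smul_one_eq_diagonal, mul_smul_comm, smul_mul_assoc, mul_one,
    frameMatrix_mul_conjTranspose hv]

theorem det_frameDiagonal {v : Fin n → EuclideanSpace ℂ (Fin n)} (hv : Orthonormal ℂ v)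
    (d : Fin n → ℝ) : (frameDiagonal v d).det = ((∏ i, d i : ℝ) : ℂ) := by
  rw [frameDiagonal, Matrix.det_mul_right_comm, frameMatrix_mul_conjTranspose hv, one_mul,
    Matrix.det_diagonal]
  push_cast
  rfl

theorem eq_frameDiagonal_eigenvalues {M : Matrix (Fin n) (Fin n) ℂ} (hM : M.IsHermitian) :
    M = frameDiagonal hM.eigenvectorBasis hM.eigenvalues := by
  conv_lhs => rw [hM.spectral_theorem, Unitary.conjStarAlgAut_apply]
  rfl

theorem posDef_frameDiagonal {v : Fin n → EuclideanSpace ℂ (Fin n)} (hv : Orthonormal ℂ v)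
    {d : Fin n → ℝ} (hd : ∀ i, 0 < d i) : (frameDiagonal v d).PosDef := by
  have hu : IsUnit (frameMatrix v) :=
    IsUnit.of_mul_eq_one _ (frameMatrix_mul_conjTranspose hv)
  rw [frameDiagonal]
  exact (Matrix.IsUnit.posDef_star_right_conjugate_iff hu).2
    (Matrix.posDef_diagonal_iff.2 fun i => by exact_mod_cast hd i)

theorem exists_frameDiagonal_exp {M : Matrix (Fin n) (Fin n) ℂ} (hM : M.PosDef) :
    ∃ v : Fin n → EuclideanSpace ℂ (Fin n), Orthonormal ℂ v ∧ ∃ x : Fin n → ℝ,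
      M = frameDiagonal v fun i => Real.exp (x i) := by
  refine ⟨hM.1.eigenvectorBasis, hM.1.eigenvectorBasis.orthonormal,
    fun i => Real.log (hM.1.eigenvalues i), ?_⟩
  simp only [Real.exp_log (hM.1.posDef_iff_eigenvalues_pos.1 hM _)]
  exact eq_frameDiagonal_eigenvalues hM.1

theorem exists_conjTranspose_mul_self {M : Matrix (Fin n) (Fin n) ℂ} (hM : M.PosSemidef) :
    ∃ B : Matrix (Fin n) (Fin n) ℂ, M = Bᴴ * B := by
  set v : Fin n → EuclideanSpace ℂ (Fin n) := ⇑hM.1.eigenvectorBasis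
  refine ⟨(frameMatrix v * Matrix.diagonal
    fun i => ((Real.sqrt (hM.1.eigenvalues i) : ℝ) : ℂ))ᴴ, ?_⟩
  conv_lhs => rw [eq_frameDiagonal_eigenvalues hM.1]
  have h : Matrix.diagonal (fun i => (hM.1.eigenvalues i : ℂ)) =
      Matrix.diagonal (fun i => ((Real.sqrt (hM.1.eigenvalues i) : ℝ) : ℂ)) *
        (Matrix.diagonal fun i => ((Real.sqrt (hM.1.eigenvalues i) : ℝ) : ℂ))ᴴ := by
    rw [Matrix.diagonal_conjTranspose, Matrix.diagonal_mul_diagonal]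
    congr 1
    ext i
    simp only [Pi.star_apply, RCLike.star_def, Complex.conj_ofReal, ← Complex.ofReal_mul,
      Real.mul_self_sqrt (hM.eigenvalues_nonneg i)]
  rw [frameDiagonal, h, Matrix.conjTranspose_conjTranspose, Matrix.conjTranspose_mul]
  simp only [mul_assoc]
  rfl

theorem exists_isUnit_mul_conjTranspose {M : Matrix (Fin n) (Fin n) ℂ} (hM : M.PosDef) :
    ∃ C, IsUnit C ∧ M = C * Cᴴ := by
  obtain ⟨B, hB⟩ := exists_conjTranspose_mul_self hM.posSemidef
  refine ⟨Bᴴ, ?_, by simpa using hB⟩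
  have h := hM.isUnit
  rw [hB] at h
  rw [Matrix.isUnit_iff_isUnit_det] at h ⊢
  rw [Matrix.det_mul] at h
  exact isUnit_of_mul_isUnit_left h

theorem log_det_frameDiagonal_exp {v : Fin n → EuclideanSpace ℂ (Fin n)} (hv : Orthonormal ℂ v)
    (x : Fin n → ℝ) :
    Real.log (frameDiagonal v fun i => Real.exp (x i)).det.re = ∑ i, x i := by
  rw [det_frameDiagonal hv, Complex.ofReal_re, ← Real.exp_sum, Real.log_exp]

theorem trace_mul_nonneg {A B : Matrix (Fin n) (Fin n) ℂ} (hA : A.PosSemidef)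
    (hB : B.PosSemidef) : 0 ≤ (A * B).trace := by
  obtain ⟨C, rfl⟩ := exists_conjTranspose_mul_self hB
  rw [← mul_assoc, Matrix.trace_mul_comm, ← mul_assoc]
  exact (hA.mul_mul_conjTranspose_same C).trace_nonneg

theorem posSemidef_of_trace_nonneg {A : Matrix (Fin n) (Fin n) ℂ}
    (h : ∀ x : Fin n → ℂ, 0 ≤ (A * Matrix.vecMulVec x (star x)).trace) : A.PosSemidef := by
  rw [← Matrix.isPositive_toEuclideanLin_iff, LinearMap.isPositive_iff_complex]
  intro x
  have := h x
  rw [Matrix.mul_vecMulVec, Matrix.trace_vecMulVec] at this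
  have h2 : inner ℂ (A.toEuclideanLin x) x = star (A *ᵥ x ⬝ᵥ star x) := by
    rw [PiLp.inner_apply]
    simp [dotProduct, mul_comm, Matrix.toLpLin_apply]
  rw [h2]
  obtain ⟨h3, h4⟩ := Complex.nonneg_iff.1 this
  refine ⟨?_, by simpa using h3⟩
  apply Complex.ext <;> simp [← h4]

/-- A Hermitian matrix `M` is scalar if `1` minimises `tr (M Z) - c log det Z`. -/
theorem eq_smul_one_of_forall_le {M : Matrix (Fin n) (Fin n) ℂ} (hM : M.IsHermitian) {c : ℝ}
    (h : ∀ Z : Matrix (Fin n) (Fin n) ℂ, Z.PosDef →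
      M.trace.re ≤ (M * Z).trace.re - c * Real.log Z.det.re) : M = (c : ℂ) • 1 := by
  obtain ⟨v, hvdef⟩ : ∃ v : Fin n → EuclideanSpace ℂ (Fin n), v = hM.eigenvectorBasis := ⟨_, rfl⟩
  have hv : Orthonormal ℂ v := hvdef ▸ hM.eigenvectorBasis.orthonormal
  set μ := hM.eigenvalues
  have hMv : M = frameDiagonal v μ := hvdef ▸ eq_frameDiagonal_eigenvalues hM
  have htr : ∀ x : Fin n → ℝ, (M * frameDiagonal v fun i => Real.exp (x i)).trace.re =
      ∑ i, μ i * Real.exp (x i) := by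
    intro x
    have : M * frameDiagonal v (fun i => Real.exp (x i)) =
        frameDiagonal v fun i => μ i * Real.exp (x i) := by
      simp only [hMv, frameDiagonal, mul_assoc]
      rw [← mul_assoc _ᴴ (frameMatrix v), conjTranspose_frameMatrix_mul hv, one_mul,
        ← mul_assoc (Matrix.diagonal _), Matrix.diagonal_mul_diagonal]
      push_cast
      rfl
    rw [this, frameDiagonal, Matrix.trace_mul_comm, ← mul_assoc, conjTranspose_frameMatrix_mul hv,
      one_mul, Matrix.trace_diagonal]
    norm_cast
  have hμ : ∀ i, μ i = c := by
    intro i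
    -- Perturbing only the `i`-th eigenvalue of `1` in an eigenbasis of `M` leaves a one-variable
    -- problem, whose critical point at `0` forces `μ i = c`.
    have hmin : ∀ t : ℝ, μ i * Real.exp 0 - c * 0 ≤ μ i * Real.exp t - c * t := by
      intro t
      have h1 := h _ (posDef_frameDiagonal hv
        (d := fun j => Real.exp ((Pi.single i t : Fin n → ℝ) j)) fun j => Real.exp_pos _)
      rw [htr, log_det_frameDiagonal_exp hv] at h1
      have h0 := htr 0
      simp only [Pi.zero_apply, Real.exp_zero, frameDiagonal_const hv] at h0
      simp only [Complex.ofReal_one, one_smul, mul_one] at h0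
      rw [h0, Finset.sum_pi_single' i t, if_pos (Finset.mem_univ _)] at h1
      rw [← Finset.add_sum_erase _ _ (Finset.mem_univ i),
        ← Finset.add_sum_erase _ _ (Finset.mem_univ i)] at h1
      have h2 : ∑ j ∈ Finset.univ.erase i, μ j * Real.exp ((Pi.single i t : Fin n → ℝ) j) =
          ∑ j ∈ Finset.univ.erase i, μ j :=
        Finset.sum_congr rfl fun j hj => by
          rw [Pi.single_eq_of_ne (Finset.ne_of_mem_erase hj), Real.exp_zero, mul_one]
      rw [h2, Pi.single_eq_same] at h1
      simp only [Real.exp_zero]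
      linarith
    have hd : HasDerivAt (fun t : ℝ => μ i * Real.exp t - c * t) (μ i * Real.exp 0 - c * 1) 0 :=
      ((Real.hasDerivAt_exp 0).const_mul _).sub ((hasDerivAt_id 0).const_mul c)
    have h0 := IsLocalMin.hasDerivAt_eq_zero (Eventually.of_forall hmin) hd
    simp only [Real.exp_zero] at h0
    linarith
  rw [hMv, funext hμ, frameDiagonal_const hv]

end Frame

/-! ### Trace matrices and existence of an energy minimiser -/

variable {k m : ℕ}

/-- The real part of `traceMatrix`; for a positive map, the two coincide. -/
noncomputable def reTraceMatrix (T : Matrix (Fin k) (Fin k) ℂ →ₗ[ℂ] Matrix (Fin m) (Fin m) ℂ)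
    (v : Fin k → EuclideanSpace ℂ (Fin k)) (w : Fin m → EuclideanSpace ℂ (Fin m)) :
    Matrix (Fin k) (Fin m) ℝ :=
  Matrix.of fun i j => (traceMatrix T v w i j).re

theorem IsPositiveMap.traceMatrix_nonneg
    {T : Matrix (Fin k) (Fin k) ℂ →ₗ[ℂ] Matrix (Fin m) (Fin m) ℂ} (hT : IsPositiveMap T)
    (v : Fin k → EuclideanSpace ℂ (Fin k)) (w : Fin m → EuclideanSpace ℂ (Fin m))
    (i : Fin k) (j : Fin m) : 0 ≤ traceMatrix T v w i j :=
  trace_mul_nonneg (hT _ (Matrix.posSemidef_vecMulVec_self_star _))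
    (Matrix.posSemidef_vecMulVec_self_star _)

theorem IsPositiveMap.reTraceMatrix_nonneg
    {T : Matrix (Fin k) (Fin k) ℂ →ₗ[ℂ] Matrix (Fin m) (Fin m) ℂ} (hT : IsPositiveMap T)
    (v : Fin k → EuclideanSpace ℂ (Fin k)) (w : Fin m → EuclideanSpace ℂ (Fin m))
    (i : Fin k) (j : Fin m) : 0 ≤ reTraceMatrix T v w i j :=
  (Complex.nonneg_iff.1 (hT.traceMatrix_nonneg v w i j)).1

theorem IsPositiveMap.traceMatrix_eq
    {T : Matrix (Fin k) (Fin k) ℂ →ₗ[ℂ] Matrix (Fin m) (Fin m) ℂ} (hT : IsPositiveMap T)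
    (v : Fin k → EuclideanSpace ℂ (Fin k)) (w : Fin m → EuclideanSpace ℂ (Fin m))
    (i : Fin k) (j : Fin m) : traceMatrix T v w i j = (reTraceMatrix T v w i j : ℂ) :=
  Complex.ext rfl (by simp [← (Complex.nonneg_iff.1 (hT.traceMatrix_nonneg v w i j)).2])

theorem trace_map_frameDiagonal
    (T : Matrix (Fin k) (Fin k) ℂ →ₗ[ℂ] Matrix (Fin m) (Fin m) ℂ)
    (v : Fin k → EuclideanSpace ℂ (Fin k)) (w : Fin m → EuclideanSpace ℂ (Fin m))
    (d : Fin k → ℝ) (e : Fin m → ℝ) :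
    (T (frameDiagonal v d) * frameDiagonal w e).trace.re =
      ∑ i, ∑ j, reTraceMatrix T v w i j * (d i * e j) := by
  rw [frameDiagonal_eq_sum, frameDiagonal_eq_sum, map_sum, Matrix.sum_mul, Matrix.trace_sum,
    Complex.re_sum]
  refine Finset.sum_congr rfl fun i _ => ?_
  rw [Matrix.mul_sum, Matrix.trace_sum, Complex.re_sum]
  refine Finset.sum_congr rfl fun j _ => ?_
  rw [map_smul, Matrix.smul_mul, Matrix.mul_smul, Matrix.trace_smul, Matrix.trace_smul,
    smul_eq_mul, smul_eq_mul, Complex.re_ofReal_mul, Complex.re_ofReal_mul]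
  simp only [reTraceMatrix, traceMatrix, Matrix.of_apply]
  ring

theorem continuous_reTraceMatrix (T : Matrix (Fin k) (Fin k) ℂ →ₗ[ℂ] Matrix (Fin m) (Fin m) ℂ)
    (i : Fin k) (j : Fin m) :
    Continuous fun p : (Fin k → EuclideanSpace ℂ (Fin k)) × (Fin m → EuclideanSpace ℂ (Fin m)) =>
      reTraceMatrix T p.1 p.2 i j := by
  have hT : Continuous T := T.continuous_of_finiteDimensional
  simp only [reTraceMatrix, traceMatrix, Matrix.of_apply]
  refine Complex.continuous_re.comp (Continuous.matrix_trace (Continuous.matrix_mul (hT.comp ?_) ?_))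
  · exact Continuous.matrix_vecMulVec (by fun_prop) (by fun_prop)
  · exact Continuous.matrix_vecMulVec (by fun_prop) (by fun_prop)

theorem isCompact_setOf_orthonormal (n : ℕ) :
    IsCompact {v : Fin n → EuclideanSpace ℂ (Fin n) | Orthonormal ℂ v} := by
  refine (isCompact_closedBall 0 1).of_isClosed_subset ?_ fun v hv => ?_
  · simp only [orthonormal_iff_ite, Set.ofPred_forall]
    exact isClosed_iInter fun i => isClosed_iInter fun j =>
      isClosed_eq (by fun_prop) continuous_const
  · rw [mem_closedBall_zero_iff, pi_norm_le_iff_of_nonneg zero_le_one]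
    exact fun i => (hv.1 i).le

theorem HasTotalSupport.rectTotalSupport
    {T : Matrix (Fin k) (Fin k) ℂ →ₗ[ℂ] Matrix (Fin m) (Fin m) ℂ} (h : HasTotalSupport T)
    {v : Fin k → EuclideanSpace ℂ (Fin k)} {w : Fin m → EuclideanSpace ℂ (Fin m)}
    (hv : Orthonormal ℂ v) (hw : Orthonormal ℂ w) : RectTotalSupport (traceMatrix T v w) := by
  have key : ∀ {n : ℕ} {u : Fin n → EuclideanSpace ℂ (Fin n)}, Orthonormal ℂ u →
      ∃ b : OrthonormalBasis (Fin n) ℂ (EuclideanSpace ℂ (Fin n)), ⇑b = u := fun {n u} hu =>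
    ⟨OrthonormalBasis.mk hu (hu.linearIndependent.span_eq_top_of_card_eq_finrank' (by simp)).ge,
      OrthonormalBasis.coe_mk _ _⟩
  obtain ⟨b, rfl⟩ := key hv
  obtain ⟨c, rfl⟩ := key hw
  exact h b c

/-- The `j`-th column sums to `⟨T(1) w_j, w_j⟩`, which is positive. -/
theorem exists_reTraceMatrix_pos
    {T : Matrix (Fin k) (Fin k) ℂ →ₗ[ℂ] Matrix (Fin m) (Fin m) ℂ} (hT1 : (T 1).PosDef)
    {v : Fin k → EuclideanSpace ℂ (Fin k)} {w : Fin m → EuclideanSpace ℂ (Fin m)}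
    (hv : Orthonormal ℂ v) (hw : Orthonormal ℂ w) (j : Fin m) :
    ∃ i, 0 < reTraceMatrix T v w i j := by
  have h1 := trace_map_frameDiagonal T v w (fun _ => 1) (Pi.single j 1)
  rw [frameDiagonal_const hv, Complex.ofReal_one, one_smul, frameDiagonal_eq_sum] at h1
  have hne : (fun a => w j a) ≠ 0 := fun h0 => by
    have : w j = 0 := by ext a; exact congrFun h0 a
    simpa [this] using hw.1 j
  have hpos := hT1.dotProduct_mulVec_pos hne
  have h2 : (T 1 * ∑ i, (((Pi.single j 1 : Fin m → ℝ) i : ℝ) : ℂ) •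
      Matrix.vecMulVec (fun a => w i a) (fun a => star (w i a))).trace =
      star (fun a => w j a) ⬝ᵥ (T 1 *ᵥ fun a => w j a) := by
    rw [Finset.sum_eq_single j (fun i _ hi => by simp [hi]) (by simp)]
    rw [Pi.single_eq_same, Complex.ofReal_one, one_smul, Matrix.mul_vecMulVec,
      Matrix.trace_vecMulVec, dotProduct_comm]
    rfl
  rw [h2] at h1
  have h3 : 0 < ∑ i, reTraceMatrix T v w i j := by
    have := (Complex.pos_iff.1 hpos).1
    rw [h1] at this
    refine this.trans_eq (Finset.sum_congr rfl fun i _ => ?_)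
    rw [Finset.sum_eq_single j (fun i _ hi => by simp [hi]) (by simp)]
    simp
  obtain ⟨i, -, hi⟩ := Finset.exists_lt_of_sum_lt (s := Finset.univ) (f := fun _ : Fin k => (0 : ℝ))
    (by simpa using h3)
  exact ⟨i, hi⟩

/-- The logarithmic barrier energy of `T` on pairs of positive definite matrices. -/
noncomputable def energy (T : Matrix (Fin k) (Fin k) ℂ →ₗ[ℂ] Matrix (Fin m) (Fin m) ℂ)
    (X : Matrix (Fin k) (Fin k) ℂ) (Y : Matrix (Fin m) (Fin m) ℂ) : ℝ :=
  (T X * Y).trace.re - m * Real.log X.det.re - k * Real.log Y.det.re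

theorem energy_frameDiagonal (T : Matrix (Fin k) (Fin k) ℂ →ₗ[ℂ] Matrix (Fin m) (Fin m) ℂ)
    {v : Fin k → EuclideanSpace ℂ (Fin k)} {w : Fin m → EuclideanSpace ℂ (Fin m)}
    (hv : Orthonormal ℂ v) (hw : Orthonormal ℂ w) (x : Fin k → ℝ) (y : Fin m → ℝ) :
    energy T (frameDiagonal v fun i => Real.exp (x i)) (frameDiagonal w fun j => Real.exp (y j)) =
      scalingPotential (reTraceMatrix T v w) m k x y := by
  rw [energy, trace_map_frameDiagonal, log_det_frameDiagonal_exp hv, log_det_frameDiagonal_exp hw,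
    scalingPotential]
  simp only [Real.exp_add]

/-- The eigenvalues are minimised out for each pair of frames; the resulting value `φ` is lower
semicontinuous on the compact set of frames. -/
theorem HasTotalSupport.exists_energy_le
    {T : Matrix (Fin k) (Fin k) ℂ →ₗ[ℂ] Matrix (Fin m) (Fin m) ℂ} (h : HasTotalSupport T)
    (hT : IsPositiveMap T) (hT1 : (T 1).PosDef) :
    ∃ X₀ Y₀, X₀.PosDef ∧ Y₀.PosDef ∧ ∀ X Y, X.PosDef → Y.PosDef →
      energy T X₀ Y₀ ≤ energy T X Y := by
  set K : Set ((Fin k → EuclideanSpace ℂ (Fin k)) × (Fin m → EuclideanSpace ℂ (Fin m))) :=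
    {v | Orthonormal ℂ v} ×ˢ {w | Orthonormal ℂ w} with hKdef
  have hK : IsCompact K := (isCompact_setOf_orthonormal k).prod (isCompact_setOf_orthonormal m)
  have hKne : K.Nonempty :=
    ⟨(EuclideanSpace.basisFun _ ℂ, EuclideanSpace.basisFun _ ℂ),
      (EuclideanSpace.basisFun _ ℂ).orthonormal, (EuclideanSpace.basisFun _ ℂ).orthonormal⟩
  have hmin : ∀ p ∈ K, ∃ x y, ∀ x' y', scalingPotential (reTraceMatrix T p.1 p.2) m k x y ≤
      scalingPotential (reTraceMatrix T p.1 p.2) m k x' y' := fun p hp =>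
    ((h.rectTotalSupport hp.1 hp.2).balancedSupport (fun i j => by
      rw [hT.traceMatrix_eq, Complex.ofReal_ne_zero]
      exact ⟨fun h0 => (hT.reTraceMatrix_nonneg _ _ _ _).lt_of_ne' h0, ne_of_gt⟩)
      (exists_reTraceMatrix_pos hT1 hp.1 hp.2)).exists_forall_le (hT.reTraceMatrix_nonneg _ _)
  have hmin' : ∀ p, ∃ x y, p ∈ K → ∀ x' y',
      scalingPotential (reTraceMatrix T p.1 p.2) m k x y ≤
        scalingPotential (reTraceMatrix T p.1 p.2) m k x' y' := fun p => by
    by_cases hp : p ∈ K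
    · obtain ⟨x, y, hxy⟩ := hmin p hp
      exact ⟨x, y, fun _ => hxy⟩
    · exact ⟨0, 0, fun h' => absurd h' hp⟩
  choose x y hxy using hmin'
  set φ : (Fin k → EuclideanSpace ℂ (Fin k)) × (Fin m → EuclideanSpace ℂ (Fin m)) → ℝ :=
    fun p => scalingPotential (reTraceMatrix T p.1 p.2) m k (x p) (y p) with hφ
  have hlsc : LowerSemicontinuousOn φ K := by
    intro p hp c hc
    -- Chosen so that the loss `δ * (m * k)` stays below `φ p - c`; the `+ 1` covers `m * k = 0`.
    set δ := (φ p - c) / (m * k + 1) with hδdef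
    have hD : (0 : ℝ) < m * k + 1 := by positivity
    have hδ : 0 < δ := div_pos (sub_pos.2 hc) hD
    have hδc : c < φ p - δ * (m * k) := by
      have : δ * (m * k + 1) = φ p - c := div_mul_cancel₀ _ hD.ne'
      linarith
    have hev : ∀ᶠ q in 𝓝 p, ∀ i j,
        reTraceMatrix T p.1 p.2 i j * Real.exp (-δ) ≤ reTraceMatrix T q.1 q.2 i j := by
      refine eventually_all.2 fun i => eventually_all.2 fun j => ?_
      -- Entries vanishing at `p` may become positive nearby, but never negative; positive entries
      -- vary continuously.
      rcases (hT.reTraceMatrix_nonneg p.1 p.2 i j).eq_or_lt with h0 | h0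
      · refine Eventually.of_forall fun q => ?_
        rw [← h0, zero_mul]
        exact hT.reTraceMatrix_nonneg q.1 q.2 i j
      · have hlt : reTraceMatrix T p.1 p.2 i j * Real.exp (-δ) < reTraceMatrix T p.1 p.2 i j :=
          mul_lt_of_lt_one_right h0 (Real.exp_lt_one_iff.2 (by linarith))
        exact ((continuous_reTraceMatrix T i j).continuousAt.eventually_const_lt hlt).mono
          fun q hq => hq.le
    filter_upwards [hev.filter_mono nhdsWithin_le_nhds] with q hq
    have := sub_le_scalingPotential (hxy p hp) hq (x q) (y q)
    rw [Fintype.card_fin] at this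
    exact hδc.trans_le this
  obtain ⟨p, hp, hpmin⟩ := hlsc.exists_isMinOn hKne hK
  refine ⟨_, _, posDef_frameDiagonal hp.1 fun i => Real.exp_pos (x p i),
    posDef_frameDiagonal hp.2 fun j => Real.exp_pos (y p j), fun X Y hX hY => ?_⟩
  obtain ⟨v, hv, a, rfl⟩ := exists_frameDiagonal_exp hX
  obtain ⟨w, hw, b, rfl⟩ := exists_frameDiagonal_exp hY
  rw [energy_frameDiagonal T hp.1 hp.2, energy_frameDiagonal T hv hw]
  exact (hpmin (show (v, w) ∈ K from ⟨hv, hw⟩)).trans (hxy (v, w) ⟨hv, hw⟩ a b)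

/-! ### Behaviour of positivity, adjoints and energy under scaling -/

theorem IsPositiveMap.traceAdjoint
    {T : Matrix (Fin k) (Fin k) ℂ →ₗ[ℂ] Matrix (Fin m) (Fin m) ℂ} (hT : IsPositiveMap T) :
    IsPositiveMap (traceAdjoint T) := by
  intro B hB
  refine posSemidef_of_trace_nonneg fun x => ?_
  have hx := Matrix.posSemidef_vecMulVec_self_star x
  have h1 := trace_mul_nonneg (hT _ hx) hB.conjTranspose
  rw [trace_map_mul_conjTranspose] at h1
  rw [← star_nonneg_iff, ← Matrix.trace_conjTranspose, Matrix.conjTranspose_mul, hx.1.eq]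
  exact h1

theorem IsPositiveMap.scale
    {T : Matrix (Fin k) (Fin k) ℂ →ₗ[ℂ] Matrix (Fin m) (Fin m) ℂ} (hT : IsPositiveMap T)
    (X : Matrix (Fin k) (Fin k) ℂ) (Y : Matrix (Fin m) (Fin m) ℂ) :
    IsPositiveMap (scale T X Y) := fun _ hA =>
  (hT _ (hA.mul_mul_conjTranspose_same X)).mul_mul_conjTranspose_same Y

theorem scale_apply (T : Matrix (Fin k) (Fin k) ℂ →ₗ[ℂ] Matrix (Fin m) (Fin m) ℂ)
    (X : Matrix (Fin k) (Fin k) ℂ) (Y : Matrix (Fin m) (Fin m) ℂ) (A : Matrix (Fin k) (Fin k) ℂ) :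
    scale T X Y A = Y * T (X * A * Xᴴ) * Yᴴ := rfl

theorem scale_scale (T : Matrix (Fin k) (Fin k) ℂ →ₗ[ℂ] Matrix (Fin m) (Fin m) ℂ)
    (X X' : Matrix (Fin k) (Fin k) ℂ) (Y Y' : Matrix (Fin m) (Fin m) ℂ) :
    scale (scale T X Y) X' Y' = scale T (X * X') (Y' * Y) := by
  ext1 A
  simp only [scale_apply, Matrix.conjTranspose_mul, mul_assoc]

theorem scale_one_one (T : Matrix (Fin k) (Fin k) ℂ →ₗ[ℂ] Matrix (Fin m) (Fin m) ℂ) :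
    scale T 1 1 = T := by
  ext1 A
  simp [scale_apply]

theorem traceAdjoint_scale (T : Matrix (Fin k) (Fin k) ℂ →ₗ[ℂ] Matrix (Fin m) (Fin m) ℂ)
    (X : Matrix (Fin k) (Fin k) ℂ) (Y : Matrix (Fin m) (Fin m) ℂ) :
    traceAdjoint (scale T X Y) = scale (traceAdjoint T) Yᴴ Xᴴ := by
  refine (eq_traceAdjoint _ _ fun A B => ?_).symm
  have h := trace_map_mul_conjTranspose T (X * A * Xᴴ) (Yᴴ * B * Y)
  simp only [scale_apply, Matrix.conjTranspose_mul, Matrix.conjTranspose_conjTranspose] at h ⊢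
  rw [mul_assoc, mul_assoc, Matrix.trace_mul_comm, mul_assoc]
  simp only [mul_assoc] at h ⊢
  rw [h, Matrix.trace_mul_comm X]
  simp only [mul_assoc]

theorem posSemidef_frameDiagonal {n : ℕ} (v : Fin n → EuclideanSpace ℂ (Fin n))
    {d : Fin n → ℝ} (hd : ∀ i, 0 ≤ d i) : (frameDiagonal v d).PosSemidef :=
  (Matrix.posSemidef_diagonal_iff.2 fun i => by exact_mod_cast hd i).mul_mul_conjTranspose_same _

/-- A positive map that is strictly positive at `1` is strictly positive. -/
theorem IsPositiveMap.map_posDef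
    {T : Matrix (Fin k) (Fin k) ℂ →ₗ[ℂ] Matrix (Fin m) (Fin m) ℂ} (hT : IsPositiveMap T)
    (hT1 : (T 1).PosDef) {Z : Matrix (Fin k) (Fin k) ℂ} (hZ : Z.PosDef) : (T Z).PosDef := by
  obtain ⟨v, hv, x, rfl⟩ := exists_frameDiagonal_exp hZ
  -- A positive lower bound for all eigenvalues `exp (x i)`; subtracting `ε • 1` leaves a positive
  -- semidefinite matrix.
  set ε := Real.exp (-∑ i, |x i|)
  have hε : ∀ i, 0 ≤ Real.exp (x i) - ε := fun i => by
    have := Finset.single_le_sum (f := fun i => |x i|) (fun i _ => abs_nonneg _)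
      (Finset.mem_univ i)
    exact sub_nonneg.2 (Real.exp_le_exp.2 (by linarith [neg_abs_le (x i)]))
  have hsplit : (frameDiagonal v fun i => Real.exp (x i)) =
      (ε : ℂ) • 1 + frameDiagonal v fun i => Real.exp (x i) - ε := by
    rw [← frameDiagonal_const hv, frameDiagonal, frameDiagonal, frameDiagonal, ← add_mul,
      ← mul_add, Matrix.diagonal_add]
    simp
  rw [hsplit, map_add, map_smul]
  refine (hT1.smul ?_).add_posSemidef (hT _ (posSemidef_frameDiagonal v hε))
  exact_mod_cast Real.exp_pos _

theorem posDef_scale_one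
    {T : Matrix (Fin k) (Fin k) ℂ →ₗ[ℂ] Matrix (Fin m) (Fin m) ℂ} (hT : IsPositiveMap T)
    (hT1 : (T 1).PosDef) {X : Matrix (Fin k) (Fin k) ℂ} {Y : Matrix (Fin m) (Fin m) ℂ}
    (hX : IsUnit X) (hY : IsUnit Y) : (scale T X Y 1).PosDef := by
  rw [scale_apply]
  exact (Matrix.IsUnit.posDef_star_right_conjugate_iff hY).2
    (hT.map_posDef hT1 ((Matrix.IsUnit.posDef_star_right_conjugate_iff hX).2 Matrix.PosDef.one))

theorem log_det_mul_mul_conjTranspose {n : ℕ} {C X : Matrix (Fin n) (Fin n) ℂ} (hC : IsUnit C)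
    (hX : X.PosDef) : Real.log (C * X * Cᴴ).det.re =
      Real.log (Complex.normSq C.det) + Real.log X.det.re := by
  have hC' : Complex.normSq C.det ≠ 0 := by
    rw [Ne, Complex.normSq_eq_zero]
    exact ((Matrix.isUnit_iff_isUnit_det _).1 hC).ne_zero
  have hX' : X.det.re ≠ 0 := (Complex.pos_iff.1 hX.det_pos).1.ne'
  rw [← Real.log_mul hC' hX', Matrix.det_mul_right_comm, Matrix.det_mul, Matrix.det_mul,
    Matrix.det_conjTranspose, RCLike.star_def, Complex.mul_conj, Complex.re_ofReal_mul]

/-- A congruence changes the energy by a constant only, so minimisers are carried to minimisers. The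
adjoint on `D` appears because it crosses the trace. -/
theorem energy_scale {T : Matrix (Fin k) (Fin k) ℂ →ₗ[ℂ] Matrix (Fin m) (Fin m) ℂ}
    {C X : Matrix (Fin k) (Fin k) ℂ} {D Y : Matrix (Fin m) (Fin m) ℂ} (hC : IsUnit C)
    (hD : IsUnit D) (hX : X.PosDef) (hY : Y.PosDef) :
    energy (scale T C Dᴴ) X Y = energy T (C * X * Cᴴ) (D * Y * Dᴴ) +
      (m * Real.log (Complex.normSq C.det) + k * Real.log (Complex.normSq D.det)) := by
  have h : (scale T C Dᴴ X * Y).trace = (T (C * X * Cᴴ) * (D * Y * Dᴴ)).trace := by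
    rw [scale_apply, Matrix.conjTranspose_conjTranspose, mul_assoc, mul_assoc,
      Matrix.trace_mul_comm]
    simp only [mul_assoc]
  rw [energy, energy, h, log_det_mul_mul_conjTranspose hC hX, log_det_mul_mul_conjTranspose hD hY]
  ring

/-- A positive map whose energy is minimal at the identity matrices is doubly stochastic up to a
scalar. -/
theorem map_one_eq_of_energy_le
    {S : Matrix (Fin k) (Fin k) ℂ →ₗ[ℂ] Matrix (Fin m) (Fin m) ℂ} (hS : IsPositiveMap S)
    (h : ∀ X Y, X.PosDef → Y.PosDef → energy S 1 1 ≤ energy S X Y) :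
    S 1 = (k : ℂ) • 1 ∧ traceAdjoint S 1 = (m : ℂ) • 1 := by
  have hS1 := hS 1 Matrix.PosSemidef.one
  have hS2 := hS.traceAdjoint 1 Matrix.PosSemidef.one
  constructor
  -- With one variable frozen at `1`, the energy is `tr (S(1) Z) - k log det Z`, respectively `tr
  -- (S*(1) Z) - m log det Z`.
  · rw [← Complex.ofReal_natCast]
    refine eq_smul_one_of_forall_le hS1.1 fun Z hZ => ?_
    simpa [energy] using h 1 Z Matrix.PosDef.one hZ
  · rw [← Complex.ofReal_natCast]
    refine eq_smul_one_of_forall_le hS2.1 fun Z hZ => ?_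
    have htr : ∀ X, (S X).trace = (traceAdjoint S 1 * X).trace := fun X => by
      have := trace_map_mul_conjTranspose S X 1
      rwa [Matrix.conjTranspose_one, mul_one, hS2.1.eq, Matrix.trace_mul_comm] at this
    simpa [energy, htr] using h Z 1 hZ Matrix.PosDef.one

theorem HasTotalSupport.exists_scale_eq
    {T : Matrix (Fin k) (Fin k) ℂ →ₗ[ℂ] Matrix (Fin m) (Fin m) ℂ} (h : HasTotalSupport T)
    (hT : IsPositiveMap T) (hT1 : (T 1).PosDef) :
    ∃ C D, IsUnit C ∧ IsUnit D ∧ scale T C D 1 = (k : ℂ) • 1 ∧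
      traceAdjoint (scale T C D) 1 = (m : ℂ) • 1 := by
  obtain ⟨X₀, Y₀, hX₀, hY₀, hmin⟩ := h.exists_energy_le hT hT1
  obtain ⟨C, hC, rfl⟩ := exists_isUnit_mul_conjTranspose hX₀
  obtain ⟨D, hD, rfl⟩ := exists_isUnit_mul_conjTranspose hY₀
  refine ⟨C, Dᴴ, hC, hD.star, map_one_eq_of_energy_le (hT.scale C Dᴴ) fun X Y hX hY => ?_⟩
  rw [energy_scale hC hD hX hY, energy_scale hC hD Matrix.PosDef.one Matrix.PosDef.one]
  simp only [mul_one]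
  exact add_le_add_left (hmin _ _ ((Matrix.IsUnit.posDef_star_right_conjugate_iff hC).2 hX)
    ((Matrix.IsUnit.posDef_star_right_conjugate_iff hD).2 hY)) _

/-! ### Normalisation and the two implications -/

theorem map_one_eq_and_posDef {S : Matrix (Fin k) (Fin k) ℂ →ₗ[ℂ] Matrix (Fin m) (Fin m) ℂ}
    (h : S (((Real.sqrt k : ℝ) : ℂ)⁻¹ • 1) = ((Real.sqrt m : ℝ) : ℂ)⁻¹ • 1) :
    S 1 = ((Real.sqrt k / Real.sqrt m : ℝ) : ℂ) • 1 ∧ (S 1).PosDef := by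
  rcases Nat.eq_zero_or_pos m with rfl | hm
  · exact ⟨Subsingleton.elim _ _, by
      rw [Subsingleton.elim (S 1) 1]; exact Matrix.PosDef.one⟩
  have hm' : 0 < Real.sqrt m := Real.sqrt_pos.2 (by exact_mod_cast hm)
  rcases Nat.eq_zero_or_pos k with rfl | hk
  -- For `k = 0 < m` the hypothesis would equate `0` with a nonzero multiple of the identity.
  · have : Nonempty (Fin m) := ⟨⟨0, hm⟩⟩
    rw [Subsingleton.elim ((((Real.sqrt (0 : ℕ) : ℝ) : ℂ)⁻¹ •
      (1 : Matrix (Fin 0) (Fin 0) ℂ))) 0, map_zero] at h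
    exact absurd h.symm (smul_ne_zero (inv_ne_zero (by exact_mod_cast hm'.ne')) one_ne_zero)
  have hk' : 0 < Real.sqrt k := Real.sqrt_pos.2 (by exact_mod_cast hk)
  have h1 : S 1 = ((Real.sqrt k / Real.sqrt m : ℝ) : ℂ) • 1 := by
    rw [map_smul] at h
    rw [Complex.ofReal_div, div_eq_mul_inv, mul_smul, ← h,
      smul_inv_smul₀ (by exact_mod_cast hk'.ne')]
  refine ⟨h1, h1 ▸ Matrix.PosDef.one.smul ?_⟩
  exact_mod_cast div_pos hk' hm'

theorem trace_frameDiagonal {n : ℕ} {v : Fin n → EuclideanSpace ℂ (Fin n)}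
    (hv : Orthonormal ℂ v) (d : Fin n → ℝ) : (frameDiagonal v d).trace.re = ∑ i, d i := by
  rw [frameDiagonal, Matrix.trace_mul_comm, ← mul_assoc, conjTranspose_frameMatrix_mul hv, one_mul,
    Matrix.trace_diagonal]
  norm_cast

/-- Summing over a full orthonormal basis replaces one projection by `1`: row sums are `tr (v_i v_i*
S*(1)) = b` and column sums are `tr (S(1) w_j w_j*) = a`. -/
theorem hasTotalSupport_of_map_one_eq
    {S : Matrix (Fin k) (Fin k) ℂ →ₗ[ℂ] Matrix (Fin m) (Fin m) ℂ} (hS : IsPositiveMap S) {a b : ℝ}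
    (ha : S 1 = (a : ℂ) • 1) (hb : traceAdjoint S 1 = (b : ℂ) • 1) : HasTotalSupport S := by
  intro v w
  have hv := v.orthonormal
  have hw := w.orthonormal
  refine rectTotalSupport_of_sum_eq (hS.traceMatrix_eq v w) (hS.reTraceMatrix_nonneg v w)
    (a := b) (b := a) (fun i => ?_) fun j => ?_
  · have h1 := trace_map_frameDiagonal S v w (Pi.single i 1) fun _ => 1
    have h2 := trace_map_mul_conjTranspose S (frameDiagonal v (Pi.single i 1)) 1
    rw [frameDiagonal_const hw, Complex.ofReal_one, one_smul] at h1
    rw [Matrix.conjTranspose_one, hb, Matrix.conjTranspose_smul, Matrix.conjTranspose_one,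
      RCLike.star_def, Complex.conj_ofReal, mul_smul_comm] at h2
    rw [h2, mul_one, Matrix.trace_smul, smul_eq_mul, Complex.re_ofReal_mul, trace_frameDiagonal hv,
      Finset.sum_eq_single i (fun l _ hl => by simp [hl]) (by simp),
      Finset.sum_eq_single i (fun l _ hl => by simp [hl]) (by simp)] at h1
    simpa using h1.symm
  · have h1 := trace_map_frameDiagonal S v w (fun _ => 1) (Pi.single j 1)
    rw [frameDiagonal_const hv, Complex.ofReal_one, one_smul, ha, smul_mul_assoc, one_mul,
      Matrix.trace_smul, smul_eq_mul, Complex.re_ofReal_mul, trace_frameDiagonal hw,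
      Finset.sum_comm, Finset.sum_eq_single j (fun l _ hl => by simp [hl]) (by simp),
      Finset.sum_eq_single j (fun l _ hl => by simp [hl]) (by simp)] at h1
    simpa using h1.symm

theorem scale_smul (T : Matrix (Fin k) (Fin k) ℂ →ₗ[ℂ] Matrix (Fin m) (Fin m) ℂ)
    (X : Matrix (Fin k) (Fin k) ℂ) (Y : Matrix (Fin m) (Fin m) ℂ) (c : ℂ)
    (A : Matrix (Fin k) (Fin k) ℂ) : scale T X (c • Y) A = (c * star c) • scale T X Y A := by
  simp only [scale_apply, Matrix.conjTranspose_smul, smul_mul_assoc, mul_smul_comm, smul_smul,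
    mul_comm]

theorem traceAdjoint_scale_smul (T : Matrix (Fin k) (Fin k) ℂ →ₗ[ℂ] Matrix (Fin m) (Fin m) ℂ)
    (X : Matrix (Fin k) (Fin k) ℂ) (Y : Matrix (Fin m) (Fin m) ℂ) (c : ℂ)
    (B : Matrix (Fin m) (Fin m) ℂ) :
    traceAdjoint (scale T X (c • Y)) B = (c * star c) • traceAdjoint (scale T X Y) B := by
  simp only [traceAdjoint_scale, scale_apply, Matrix.conjTranspose_smul, smul_mul_assoc,
    mul_smul_comm, map_smul, smul_smul, Matrix.conjTranspose_conjTranspose, star_star]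

/-- A map with `T 1 = k • 1` and `T* 1 = m • 1` becomes doubly stochastic after multiplication by a
scalar. -/
theorem exists_isDoublyStochastic_smul
    {T : Matrix (Fin k) (Fin k) ℂ →ₗ[ℂ] Matrix (Fin m) (Fin m) ℂ} (hT : IsPositiveMap T)
    {X : Matrix (Fin k) (Fin k) ℂ} {Y : Matrix (Fin m) (Fin m) ℂ} (hk : 0 < k) (hm : 0 < m)
    (h1 : scale T X Y 1 = (k : ℂ) • 1) (h2 : traceAdjoint (scale T X Y) 1 = (m : ℂ) • 1) :
    ∃ c : ℂ, c ≠ 0 ∧ IsDoublyStochastic (scale T X (c • Y)) := by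
  have hk' : 0 < Real.sqrt k := Real.sqrt_pos.2 (by exact_mod_cast hk)
  have hm' : 0 < Real.sqrt m := Real.sqrt_pos.2 (by exact_mod_cast hm)
  have hkk : (k : ℂ) = ((Real.sqrt k : ℝ) : ℂ) * ((Real.sqrt k : ℝ) : ℂ) := by
    rw [← Complex.ofReal_mul, Real.mul_self_sqrt (Nat.cast_nonneg k), Complex.ofReal_natCast]
  have hmm : (m : ℂ) = ((Real.sqrt m : ℝ) : ℂ) * ((Real.sqrt m : ℝ) : ℂ) := by
    rw [← Complex.ofReal_mul, Real.mul_self_sqrt (Nat.cast_nonneg m), Complex.ofReal_natCast]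
  have hkc : ((Real.sqrt k : ℝ) : ℂ) ≠ 0 := by exact_mod_cast hk'.ne'
  have hmc : ((Real.sqrt m : ℝ) : ℂ) ≠ 0 := by exact_mod_cast hm'.ne'
  -- Both normalisations require `|c|² = 1 / √(k m)`: the first reads `|c|² * k / √k = 1 / √m`, the
  -- second is symmetric.
  set r := (Real.sqrt k * Real.sqrt m)⁻¹ with hr
  have hr0 : 0 < r := inv_pos.2 (mul_pos hk' hm')
  set c : ℂ := ((Real.sqrt r : ℝ) : ℂ) with hcdef
  have hc : c * star c =
      (((Real.sqrt k : ℝ) : ℂ) * ((Real.sqrt m : ℝ) : ℂ))⁻¹ := by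
    rw [hcdef, RCLike.star_def, Complex.conj_ofReal, ← Complex.ofReal_mul,
      Real.mul_self_sqrt hr0.le, hr]
    push_cast
    rfl
  refine ⟨c, Complex.ofReal_ne_zero.2 (Real.sqrt_pos.2 hr0).ne', hT.scale _ _, ?_, ?_⟩
  · rw [map_smul, scale_smul, h1, hc, smul_smul, smul_smul, hkk]
    congr 1
    field_simp
  · rw [map_smul, traceAdjoint_scale_smul, h2, hc, smul_smul, smul_smul, hmm]
    congr 1
    field_simp

theorem scale_inv_inv (T : Matrix (Fin k) (Fin k) ℂ →ₗ[ℂ] Matrix (Fin m) (Fin m) ℂ)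
    {X : Matrix (Fin k) (Fin k) ℂ} {Y : Matrix (Fin m) (Fin m) ℂ} (hX : IsUnit X)
    (hY : IsUnit Y) : scale (scale T X Y) X⁻¹ Y⁻¹ = T := by
  rw [scale_scale, Matrix.mul_nonsing_inv _ ((Matrix.isUnit_iff_isUnit_det _).1 hX),
    Matrix.nonsing_inv_mul _ ((Matrix.isUnit_iff_isUnit_det _).1 hY), scale_one_one]

theorem IsDoublyStochastic.posDef_of_areEquivalent
    {T S : Matrix (Fin k) (Fin k) ℂ →ₗ[ℂ] Matrix (Fin m) (Fin m) ℂ} (hS : IsDoublyStochastic S)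
    (h : AreEquivalent T S) : (T 1).PosDef ∧ (traceAdjoint T 1).PosDef := by
  obtain ⟨X, Y, hX, hY, rfl⟩ := h
  have hX' := Matrix.isUnit_nonsing_inv_iff.2 hX
  have hY' := Matrix.isUnit_nonsing_inv_iff.2 hY
  rw [← scale_inv_inv T hX hY]
  refine ⟨posDef_scale_one hS.positive (map_one_eq_and_posDef hS.map_id).2 hX' hY', ?_⟩
  rw [traceAdjoint_scale]
  exact posDef_scale_one hS.positive.traceAdjoint (map_one_eq_and_posDef hS.adjoint_map_id).2
    hY'.star hX'.star

theorem HasTotalSupport.exists_isDoublyStochastic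
    {T : Matrix (Fin k) (Fin k) ℂ →ₗ[ℂ] Matrix (Fin m) (Fin m) ℂ} (h : HasTotalSupport T)
    (hT : IsPositiveMap T) (hT1 : (T 1).PosDef) (hT2 : (traceAdjoint T 1).PosDef) :
    ∃ X Y, IsUnit X ∧ IsUnit Y ∧ IsDoublyStochastic (scale T X Y) := by
  -- If exactly one dimension is zero, then `T 1` or `T* 1` is a zero matrix of positive size, which
  -- is not positive definite.
  rcases Nat.eq_zero_or_pos k with rfl | hk
  · rcases Nat.eq_zero_or_pos m with rfl | hm
    · exact ⟨1, 1, isUnit_one, isUnit_one, hT.scale 1 1, Subsingleton.elim _ _,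
        Subsingleton.elim _ _⟩
    · have := hT1.diag_pos (i := ⟨0, hm⟩)
      rw [Subsingleton.elim (1 : Matrix (Fin 0) (Fin 0) ℂ) 0, map_zero] at this
      exact absurd this (lt_irrefl _)
  rcases Nat.eq_zero_or_pos m with rfl | hm
  · have := hT2.diag_pos (i := ⟨0, hk⟩)
    rw [Subsingleton.elim (1 : Matrix (Fin 0) (Fin 0) ℂ) 0, map_zero] at this
    exact absurd this (lt_irrefl _)
  obtain ⟨C, D, hC, hD, h1, h2⟩ := h.exists_scale_eq hT hT1
  obtain ⟨c, hc, hds⟩ := exists_isDoublyStochastic_smul hT hk hm h1 h2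
  exact ⟨C, c • D, hC, hD.smul (Units.mk0 c hc), hds⟩

end PosMap

theorem theorem3p9 (k m : ℕ)
    (T : Matrix (Fin k) (Fin k) ℂ →ₗ[ℂ] Matrix (Fin m) (Fin m) ℂ)
    (hT : PosMap.IsPositiveMap T) :
    (∃ S : Matrix (Fin k) (Fin k) ℂ →ₗ[ℂ] Matrix (Fin m) (Fin m) ℂ,
        PosMap.IsDoublyStochastic S ∧ PosMap.AreEquivalent T S) ↔
      ((T 1).PosDef ∧ (PosMap.traceAdjoint T 1).PosDef ∧
        ∃ (X' : Matrix (Fin k) (Fin k) ℂ) (Y' : Matrix (Fin m) (Fin m) ℂ),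
          IsUnit X' ∧ IsUnit Y' ∧ PosMap.HasTotalSupport (PosMap.scale T X' Y')) := by
  constructor
  · rintro ⟨S, hS, hTS⟩
    obtain ⟨h1, h2⟩ := hS.posDef_of_areEquivalent hTS
    obtain ⟨X, Y, hX, hY, rfl⟩ := hTS
    exact ⟨h1, h2, X, Y, hX, hY, PosMap.hasTotalSupport_of_map_one_eq hS.positive
      (PosMap.map_one_eq_and_posDef hS.map_id).1 (PosMap.map_one_eq_and_posDef hS.adjoint_map_id).1⟩
  · rintro ⟨h1, h2, X, Y, hX, hY, h⟩
    obtain ⟨C, D, hC, hD, hds⟩ := h.exists_isDoublyStochastic (hT.scale X Y)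
      (PosMap.posDef_scale_one hT h1 hX hY) (by
        rw [PosMap.traceAdjoint_scale]
        exact PosMap.posDef_scale_one hT.traceAdjoint h2 hY.star hX.star)
    rw [PosMap.scale_scale] at hds
    exact ⟨_, hds, X * C, D * Y, hX.mul hC, hD.mul hY, rfl⟩
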